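/- For $n\ge 1$ and $k\ge 1$, consider the $2^k\binom{n}{k}$ possible $k$-clauses over the variables $x_1,\dots,x_n$ (a $k$-clause is a disjunction of $k$ literals over $k$ distinct variables). For $0\le m\le 2^k\binom{n}{k}$ let $\mathcal{P}^{\mathrm{sat}}_{n,m}$ be the distribution of the random $k$-CNF formula obtained as follows: order all $2^k\binom nk$ clauses by a uniformly random permutation and, starting from the empty formula, go over the first $m$ clauses in this order one by one, including each clause if and only if the formula remains satisfiable after its addition. Then for every fixed $k\ge 1$ there is a constant $c=c(k)>0$ such that the following holds. Let $m=m(n)$ be any sequence of integers with $c\log n\le m/n$ and $m\le 2^k\binom nk$ for all sufficiently large $n$, and let $F$ be drawn from $\mathcal{P}^{\mathrm{sat}}_{n,m}$. Then, with probability tending to $1$ as $n\to\infty$, $F$ has exactly one satisfying assignment. -/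

import Mathlib

namespace RandomSat

/-- A literal over the variables `x_i`, `i : Fin n`; `(i, true)` is `x_i` and
`(i, false)` is its negation. -/
abbrev Literal (n : ℕ) : Type := Fin n × Bool

/-- A `k`-clause: a set of `k` literals over pairwise distinct variables. -/
abbrev Clause (n k : ℕ) : Type :=
  {C : Finset (Literal n) // C.card = k ∧ ∀ l ∈ C, ∀ l' ∈ C, l.1 = l'.1 → l = l'}

/-- A `k`-CNF formula: a (finite) set of `k`-clauses. -/
abbrev Formula (n k : ℕ) : Type := Finset (Clause n k)

/-- A truth assignment to the `n` variables. -/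
abbrev Assignment (n : ℕ) : Type := Fin n → Bool

/-- The assignment makes at least one literal of the clause true. -/
def Clause.SatBy {n k : ℕ} (C : Clause n k) (σ : Assignment n) : Prop :=
  ∃ l ∈ C.1, σ l.1 = l.2

/-- The assignment satisfies every clause of the formula. -/
def Formula.SatBy {n k : ℕ} (F : Formula n k) (σ : Assignment n) : Prop :=
  ∀ C ∈ F, Clause.SatBy C σ

def Formula.Satisfiable {n k : ℕ} (F : Formula n k) : Prop :=
  ∃ σ : Assignment n, Formula.SatBy F σ

open Classical in
/-- One step of the process: include the clause if the formula remains satisfiable. -/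
noncomputable def step {n k : ℕ} (F : Formula n k) (C : Clause n k) : Formula n k :=
  if Formula.Satisfiable (insert C F) then insert C F else F

/-- Starting from the empty formula, go over the clauses of a list one by one. -/
noncomputable def scan {n k : ℕ} (L : List (Clause n k)) : Formula n k :=
  L.foldl step ∅

/-- An ordering (permutation) of all `k`-clauses: position `i` is occupied by `e i`. -/
abbrev Ordering (n k : ℕ) : Type := Fin (Fintype.card (Clause n k)) ≃ Clause n k

instance instNonemptyOrdering (n k : ℕ) : Nonempty (Ordering n k) :=
  ⟨(Fintype.equivFin (Clause n k)).symm⟩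

/-- The formula obtained after scanning the first `m` clauses of an ordering. -/
noncomputable def processFormula {n k : ℕ} (m : ℕ) (e : Ordering n k) : Formula n k :=
  scan ((List.ofFn e).take m)

/-- The distribution of the formula obtained after scanning the first `m` clauses of a
uniformly random ordering of all `k`-clauses over `n` variables. -/
noncomputable def Psat (k n m : ℕ) : PMF (Formula n k) :=
  (PMF.uniformOfFintype (Ordering n k)).map (processFormula m)

end RandomSat

namespace RandomSat

/-! ### Random orderings that avoid a set of clauses -/

section Avoid

variable {α : Type*}

/-! Any two solutions of the current formula satisfy the same scanned clauses, rejected ones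
included (`satBy_of_satBy_scan`): a scanned clause true under one solution was accepted, hence is
true under the other. So a clause separating two solutions cannot have been scanned, and ambiguity
forces the ordering to avoid many clauses.

Split the scan at `a = m / 2`. If fewer than `n / 4` variables are frozen after `a` steps,
`exists_of_card_frozen_lt` yields a set of at least `n / 4` variables for which a constant fraction
of all clauses is avoided. This has probability `exp (-Ω(m))`, which beats the union bound over the
`4 ^ n` pairs of an assignment and a set of variables. Otherwise, one scanned clause made of a
variable `i` and `k - 1` frozen variables, all falsified by some solution, freezes `i`
(`notMem_oneOf_frozen`). Such clauses have density of order at least `1 / n`, so the second half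
misses them with probability `exp (-Ω(m / n))`, which beats the union bound over `i` once `m / n ≥ c
log n`. `card_avoiding_le` supplies both tail bounds. -/

theorem mem_take_ofFn {N : ℕ} (f : Fin N → α) (b : ℕ) (x : α) :
    x ∈ (List.ofFn f).take b ↔ ∃ j : Fin N, j.1 < b ∧ f j = x := by
  rw [List.mem_take_iff_getElem]
  constructor
  · rintro ⟨i, hi, rfl⟩
    have hi' := hi
    simp only [List.length_ofFn, lt_inf_iff] at hi'
    exact ⟨⟨i, hi'.2⟩, hi'.1, by simp⟩
  · rintro ⟨j, hj, rfl⟩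
    exact ⟨j, by simp [hj], by simp⟩

theorem take_ofFn_swap {N : ℕ} (e : Fin N ≃ α) (a : ℕ) (i j : Fin N) (hi : a ≤ i.1)
    (hj : a ≤ j.1) :
    (List.ofFn ((Equiv.swap i j).trans e)).take a = (List.ofFn e).take a := by
  apply List.ext_getElem
  · simp
  · intro r h h2
    have h1 : r < a ∧ r < N := by simpa using h
    have h3 : (⟨r, h1.2⟩ : Fin N) ≠ i := by
      intro h
      subst h
      exact absurd h1.1 (not_lt.2 hi)
    have h4 : (⟨r, h1.2⟩ : Fin N) ≠ j := by
      intro h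
      subst h
      exact absurd h1.1 (not_lt.2 hj)
    simp [Equiv.swap_apply_of_ne_of_ne h3 h4]

variable [Fintype α]

open Classical in
/-- The orderings whose first `a` entries `L` satisfy `P` and whose first `b` entries avoid
the set `T L`. -/
noncomputable def avoiding (P : List α → Prop) (T : List α → Finset α) (a b : ℕ) :
    Finset (Fin (Fintype.card α) ≃ α) :=
  Finset.univ.filter fun e =>
    P ((List.ofFn e).take a) ∧ ∀ x ∈ (List.ofFn e).take b, x ∉ T ((List.ofFn e).take a)

theorem mem_avoiding {P : List α → Prop} {T : List α → Finset α} {a b : ℕ}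
    {e : Fin (Fintype.card α) ≃ α} :
    e ∈ avoiding P T a b ↔ P ((List.ofFn e).take a) ∧
      ∀ j : Fin (Fintype.card α), j.1 < b → e j ∉ T ((List.ofFn e).take a) := by
  classical
  simp only [avoiding, Finset.mem_filter, Finset.mem_univ, true_and, mem_take_ofFn]
  refine and_congr_right fun _ => ⟨fun h j hj => h _ ⟨j, hj, rfl⟩, ?_⟩
  rintro h _ ⟨j, hj, rfl⟩
  exact h j hj

theorem avoiding_swap {P : List α → Prop} {T : List α → Finset α} {a b : ℕ} (hab : a ≤ b)
    {e : Fin (Fintype.card α) ≃ α} (he : e ∈ avoiding P T a b) (i j : Fin (Fintype.card α))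
    (hi : b ≤ i.1) (hj : b ≤ j.1) : (Equiv.swap i j).trans e ∈ avoiding P T a b := by
  rw [mem_avoiding] at he ⊢
  rw [take_ofFn_swap e a i j (hab.trans hi) (hab.trans hj)]
  refine ⟨he.1, fun r hr => ?_⟩
  rw [Equiv.trans_apply, Equiv.swap_apply_of_ne_of_ne]
  · exact he.2 r hr
  · rintro rfl; omega
  · rintro rfl; omega

/-- Double counting of pairs of an avoiding ordering and a position `j ≥ b` holding a forbidden
element. Swapping `j` with `b` makes the ordering fail at position `b`, and this is injective for
fixed `j`. The forbidden set survives the swap because it depends on the first `a ≤ b` entries only.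
-/
theorem card_avoiding_succ_le (P : List α → Prop) (T : List α → Finset α) {a b : ℕ}
    (hab : a ≤ b) (t : ℝ) (ht : ∀ L, P L → t ≤ (T L).card) :
    t * (avoiding P T a b).card ≤ (Fintype.card α : ℝ) *
      ((avoiding P T a b).card - (avoiding P T a (b + 1)).card) := by
  classical
  set A := avoiding P T a b
  set A' := avoiding P T a (b + 1)
  have hsub : A' ⊆ A := fun e he => by
    rw [mem_avoiding] at he ⊢
    exact ⟨he.1, fun j hj => he.2 j (by omega)⟩
  have hdiff : ((A \ A').card : ℝ) = (A.card : ℝ) - A'.card := by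
    rw [Finset.card_sdiff_of_subset hsub, Nat.cast_sub (Finset.card_le_card hsub)]
  rw [← hdiff]
  let R : (Fin (Fintype.card α) ≃ α) → Fin (Fintype.card α) → Prop :=
    fun e j => b ≤ j.1 ∧ e j ∈ T ((List.ofFn e).take a)
  have hlow : ∀ e ∈ A, t ≤ ((Finset.univ.filter (R e)).card : ℝ) := by
    intro e he
    obtain ⟨h1, h2⟩ := mem_avoiding.1 he
    refine (ht _ h1).trans ?_
    -- Avoidance up to `b` pushes every forbidden element to a position at least `b`.
    have : (T ((List.ofFn e).take a)) ⊆ (Finset.univ.filter (R e)).map e.toEmbedding := by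
      intro x hx
      rw [Finset.mem_map]
      refine ⟨e.symm x, ?_, by simp⟩
      simp only [R, Finset.mem_filter, Finset.mem_univ, true_and, Equiv.apply_symm_apply, hx,
        and_true]
      by_contra hlt
      exact h2 (e.symm x) (by omega) (by simpa using hx)
    exact_mod_cast (Finset.card_le_card this).trans_eq (Finset.card_map _)
  have hup : ∀ j, (A.filter fun e => R e j).card ≤ (A \ A').card := by
    intro j
    by_cases hj : b ≤ j.1
    · let j0 : Fin (Fintype.card α) := ⟨b, lt_of_le_of_lt hj j.2⟩
      refine Finset.card_le_card_of_injOn (fun e => (Equiv.swap j j0).trans e) ?_ ?_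
      · intro e he
        simp only [R, Finset.coe_filter, Set.mem_ofPred_eq] at he
        obtain ⟨heA, -, hT⟩ := he
        simp only [Finset.coe_sdiff, Set.mem_sdiff, Finset.mem_coe]
        refine ⟨avoiding_swap hab heA j j0 hj le_rfl, fun h => ?_⟩
        have h2 := (mem_avoiding.1 h).2 j0 (Nat.lt_succ_self b)
        rw [take_ofFn_swap e a j j0 (hab.trans hj) hab] at h2
        exact h2 (by simpa using hT)
      · intro e _ e' _ h
        ext r
        have := congrArg (fun f : Fin (Fintype.card α) ≃ α => f (Equiv.swap j j0 r)) h
        simpa using this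
    · simp [R, hj]
  calc t * (A.card : ℝ) = ∑ e ∈ A, t := by simp [mul_comm]
    _ ≤ ∑ e ∈ A, ((Finset.univ.filter (R e)).card : ℝ) := Finset.sum_le_sum hlow
    _ = ∑ j, ((A.filter fun e => R e j).card : ℝ) := by
      exact_mod_cast Finset.sum_card_bipartiteAbove_eq_sum_card_bipartiteBelow R
    _ ≤ ∑ _j : Fin (Fintype.card α), ((A \ A').card : ℝ) :=
      Finset.sum_le_sum fun j _ => by exact_mod_cast hup j
    _ = (Fintype.card α : ℝ) * ((A \ A').card : ℝ) := by simp

/-- If the set to be avoided always has at least `r * card α` elements, then the proportion of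
orderings avoiding it decays exponentially in the number of entries read. -/
theorem card_avoiding_le [Nonempty α] (P : List α → Prop) (T : List α → Finset α) {a b : ℕ}
    (hab : a ≤ b) (r : ℝ) (ht : ∀ L, P L → r * Fintype.card α ≤ (T L).card) :
    ((avoiding P T a b).card : ℝ) ≤
      Real.exp (-(r * ((b : ℝ) - a))) * Nat.card (Fin (Fintype.card α) ≃ α) := by
  classical
  induction b, hab using Nat.le_induction with
  | base =>
    simpa [Nat.card_eq_fintype_card] using Finset.card_le_univ (avoiding P T a a)
  | succ b hab ih =>
    have hN : (0 : ℝ) < Fintype.card α := by exact_mod_cast Fintype.card_pos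
    have h := card_avoiding_succ_le P T hab _ ht
    have h1 : r * ((avoiding P T a b).card : ℝ) ≤
        (avoiding P T a b).card - (avoiding P T a (b + 1)).card := by
      refine le_of_mul_le_mul_left ?_ hN
      linarith
    have h2 : ((avoiding P T a (b + 1)).card : ℝ) ≤ (1 - r) * (avoiding P T a b).card := by
      linarith
    have h3 : 1 - r ≤ Real.exp (-r) := by
      have := Real.add_one_le_exp (-r)
      linarith
    calc ((avoiding P T a (b + 1)).card : ℝ) ≤ (1 - r) * (avoiding P T a b).card := h2
      _ ≤ Real.exp (-r) * (avoiding P T a b).card := by gcongr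
      _ ≤ Real.exp (-r) * (Real.exp (-(r * ((b : ℝ) - a))) *
          Nat.card (Fin (Fintype.card α) ≃ α)) := by gcongr
      _ = _ := by
        rw [← mul_assoc, ← Real.exp_add]
        push_cast
        ring_nf

end Avoid

/-! ### Solutions of the scanned formula and the clauses they exclude -/

section Structure

variable {n k : ℕ}

theorem scan_append_singleton (L : List (Clause n k)) (C : Clause n k) :
    scan (L ++ [C]) = step (scan L) C := by
  simp [scan, List.foldl_append]

theorem subset_step (F : Formula n k) (C : Clause n k) : F ⊆ step F C := by
  classical
  unfold step
  split_ifs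
  · exact fun x hx => Finset.mem_insert_of_mem hx
  · exact subset_rfl

theorem satisfiable_scan (L : List (Clause n k)) : (scan L).Satisfiable := by
  classical
  induction L using List.reverseRecOn with
  | nil => exact ⟨fun _ => true, fun C hC => by simp [scan] at hC⟩
  | append_singleton L C ih =>
    rw [scan_append_singleton]
    unfold step
    split_ifs with h
    · exact h
    · exact ih

theorem scan_subset_append (L L' : List (Clause n k)) : scan L ⊆ scan (L ++ L') := by
  induction L' using List.reverseRecOn with
  | nil => simp
  | append_singleton L' C ih =>
    rw [← List.append_assoc, scan_append_singleton]
    exact ih.trans (subset_step _ _)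

theorem Formula.SatBy.of_append {L L' : List (Clause n k)} {σ : Assignment n}
    (h : Formula.SatBy (scan (L ++ L')) σ) : Formula.SatBy (scan L) σ :=
  fun C hC => h C (scan_subset_append L L' hC)

/-- Two satisfying assignments of the scanned formula satisfy the same scanned clauses. -/
theorem satBy_of_satBy_scan {L : List (Clause n k)} {σ τ : Assignment n}
    (hσ : Formula.SatBy (scan L) σ) (hτ : Formula.SatBy (scan L) τ) {C : Clause n k}
    (hC : C ∈ L) (h : C.SatBy σ) : C.SatBy τ := by
  classical
  induction L using List.reverseRecOn with
  | nil => simp at hC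
  | append_singleton L C' ih =>
    rcases List.mem_append.1 hC with hC | hC
    · exact ih hσ.of_append hτ.of_append hC
    · obtain rfl : C = C' := by simpa using hC
      -- It suffices that `C` was accepted, and `σ` witnesses that accepting it keeps the formula
      -- satisfiable.
      refine hτ C ?_
      rw [scan_append_singleton]
      unfold step
      rw [if_pos]
      · exact Finset.mem_insert_self _ _
      · refine ⟨σ, fun C'' hC'' => ?_⟩
        rcases Finset.mem_insert.1 hC'' with rfl | hC''
        · exact h
        · exact hσ.of_append C'' hC''

/-- The clause on the variable set `S` that `ρ` falsifies; a clause of width `k` only if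
`S.card = k`. -/
def falsified (ρ : Assignment n) (S : Finset (Fin n)) (hS : S.card = k) : Clause n k :=
  ⟨S.image fun i => (i, !ρ i), by
    rw [Finset.card_image_of_injective _ fun i j h => (Prod.mk.inj h).1, hS], by
    intro l hl l' hl' h
    obtain ⟨i, -, rfl⟩ := Finset.mem_image.1 hl
    obtain ⟨j, -, rfl⟩ := Finset.mem_image.1 hl'
    obtain rfl : i = j := h
    rfl⟩

theorem satBy_falsified {ρ σ : Assignment n} {S : Finset (Fin n)} {hS : S.card = k} :
    (falsified ρ S hS).SatBy σ ↔ ∃ i ∈ S, σ i ≠ ρ i := by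
  simp only [Clause.SatBy, falsified, Finset.mem_image]
  constructor
  · rintro ⟨_, ⟨i, hi, rfl⟩, h⟩
    exact ⟨i, hi, by simp at h; simp [h]⟩
  · rintro ⟨i, hi, h⟩
    exact ⟨_, ⟨i, hi, rfl⟩, by simpa [Bool.eq_not] using h⟩

theorem falsified_injective {ρ : Assignment n} {S S' : Finset (Fin n)} {hS : S.card = k}
    {hS' : S'.card = k} (h : falsified ρ S hS = falsified ρ S' hS') : S = S' := by
  have h1 : S.image (fun i => (i, !ρ i)) = S'.image (fun i => (i, !ρ i)) :=
    congrArg Subtype.val h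
  exact Finset.image_injective (fun i j h => (Prod.mk.inj h).1) h1

open Classical in
/-- The clauses falsified by `ρ` whose variable set belongs to the family `𝒮`. -/
noncomputable def falsifiedFamily (k : ℕ) (ρ : Assignment n) (𝒮 : Finset (Finset (Fin n))) :
    Finset (Clause n k) :=
  Finset.univ.filter fun C => ∃ S ∈ 𝒮, ∃ hS : S.card = k, C = falsified ρ S hS

theorem mem_falsifiedFamily {ρ : Assignment n} {𝒮 : Finset (Finset (Fin n))} {C : Clause n k} :
    C ∈ falsifiedFamily k ρ 𝒮 ↔ ∃ S ∈ 𝒮, ∃ hS : S.card = k, C = falsified ρ S hS := by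
  simp [falsifiedFamily]

theorem card_le_card_falsifiedFamily {ρ : Assignment n} {𝒮 : Finset (Finset (Fin n))}
    (h : ∀ S ∈ 𝒮, S.card = k) : 𝒮.card ≤ (falsifiedFamily k ρ 𝒮).card := by
  classical
  rw [← Finset.card_attach]
  refine Finset.card_le_card_of_injOn (fun S => falsified ρ S.1 (h S.1 S.2)) ?_ ?_
  · intro S _
    exact mem_falsifiedFamily.2 ⟨S.1, S.2, h S.1 S.2, rfl⟩
  · intro S _ S' _ hSS
    exact Subtype.ext (falsified_injective hSS)

/-- The sets of size `k` consisting of one element of `V` and `k - 1` elements of `X`. -/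
def oneOf (k : ℕ) (V X : Finset (Fin n)) : Finset (Finset (Fin n)) :=
  (V ×ˢ X.powersetCard (k - 1)).image fun p => insert p.1 p.2

theorem mem_oneOf {V X S : Finset (Fin n)} :
    S ∈ oneOf k V X ↔ ∃ i ∈ V, ∃ S' ⊆ X, S'.card = k - 1 ∧ insert i S' = S := by
  simp only [oneOf, Finset.mem_image, Finset.mem_product, Finset.mem_powersetCard, Prod.exists]
  constructor
  · rintro ⟨i, S', ⟨h1, h2, h3⟩, h4⟩
    exact ⟨i, h1, S', h2, h3, h4⟩
  · rintro ⟨i, h1, S', h2, h3, h4⟩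
    exact ⟨i, S', ⟨h1, h2, h3⟩, h4⟩

theorem card_of_mem_oneOf (hk : 1 ≤ k) {V X S : Finset (Fin n)} (hVX : Disjoint V X)
    (hS : S ∈ oneOf k V X) : S.card = k := by
  obtain ⟨i, hi, S', hS', hc, rfl⟩ := mem_oneOf.1 hS
  rw [Finset.card_insert_of_notMem, hc, Nat.sub_add_cancel hk]
  exact fun h => Finset.disjoint_left.1 hVX hi (hS' h)

theorem card_oneOf {V X : Finset (Fin n)} (hVX : Disjoint V X) :
    (oneOf k V X).card = V.card * X.card.choose (k - 1) := by
  rw [oneOf, Finset.card_image_of_injOn, Finset.card_product, Finset.card_powersetCard]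
  rintro ⟨i, S⟩ h ⟨j, S'⟩ h' heq
  simp only [Finset.coe_product, Set.mem_prod, Finset.mem_coe, Finset.mem_powersetCard] at h h'
  -- Intersecting with `V` and `X` recovers the pair from the inserted set.
  have key : ∀ {i S}, i ∈ V → S ⊆ X → (insert i S) ∩ V = {i} ∧ (insert i S) ∩ X = S := by
    intro i S hi hS
    constructor
    · ext x
      simp only [Finset.mem_inter, Finset.mem_insert, Finset.mem_singleton]
      constructor
      · rintro ⟨rfl | hx, hV⟩
        · rfl
        · exact absurd (hS hx) (Finset.disjoint_left.1 hVX hV)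
      · rintro rfl
        exact ⟨Or.inl rfl, hi⟩
    · ext x
      simp only [Finset.mem_inter, Finset.mem_insert]
      constructor
      · rintro ⟨rfl | hx, hX⟩
        · exact absurd hX (Finset.disjoint_left.1 hVX hi)
        · exact hx
      · exact fun hx => ⟨Or.inr hx, hS hx⟩
  have h1 := key h.1 h.2.1
  have h2 := key h'.1 h'.2.1
  simp only at heq
  rw [heq] at h1
  have hi : ({j} : Finset (Fin n)) = {i} := h2.1.symm.trans h1.1
  have hS : S' = S := h2.2.symm.trans h1.2
  rw [Finset.singleton_inj.1 hi, hS]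

/-- The variables on which two assignments differ. -/
def diff (σ τ : Assignment n) : Finset (Fin n) := Finset.univ.filter fun i => σ i ≠ τ i

theorem mem_diff {σ τ : Assignment n} {i : Fin n} : i ∈ diff σ τ ↔ σ i ≠ τ i := by
  simp [diff]

/-- The assignment `σ` flipped on `W`. -/
def flipOn (σ : Assignment n) (W : Finset (Fin n)) : Assignment n :=
  fun i => if i ∈ W then !σ i else σ i

open Classical in
/-- The satisfying assignments of a formula. -/
noncomputable def solutions (F : Formula n k) : Finset (Assignment n) :=
  Finset.univ.filter fun σ => F.SatBy σ

theorem mem_solutions {F : Formula n k} {σ : Assignment n} : σ ∈ solutions F ↔ F.SatBy σ := by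
  simp [solutions]

open Classical in
/-- The variables that take the same value in all satisfying assignments. -/
noncomputable def frozen (F : Formula n k) : Finset (Fin n) :=
  Finset.univ.filter fun i => ∀ σ τ, F.SatBy σ → F.SatBy τ → σ i = τ i

theorem mem_frozen {F : Formula n k} {i : Fin n} :
    i ∈ frozen F ↔ ∀ σ τ, F.SatBy σ → F.SatBy τ → σ i = τ i := by
  simp [frozen]

/-- Such a clause is false under `τ` but true under `σ`, as `σ` disagrees with `τ` on all its
variables and there is at least one. -/
theorem notMem_powersetCard_diff (hk : 1 ≤ k) {L : List (Clause n k)} {σ τ : Assignment n}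
    (hσ : Formula.SatBy (scan L) σ) (hτ : Formula.SatBy (scan L) τ) {C : Clause n k}
    (hC : C ∈ L) : C ∉ falsifiedFamily k τ ((diff σ τ).powersetCard k) := by
  intro h
  obtain ⟨S, hS, hc, rfl⟩ := mem_falsifiedFamily.1 h
  obtain ⟨i, hi⟩ := Finset.card_pos.1 (hc ▸ hk : 0 < S.card)
  have h1 := satBy_of_satBy_scan hσ hτ hC
    (satBy_falsified.2 ⟨i, hi, mem_diff.1 ((Finset.mem_powersetCard.1 hS).1 hi)⟩)
  obtain ⟨j, -, hj⟩ := satBy_falsified.1 h1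
  exact hj rfl

/-- The literal inside the union is true under `σ` and false under some `τ ∈ X`; the remaining
literals are false under `σ`, hence under `τ`, which agrees with `σ` outside the union. -/
theorem notMem_oneOf_biUnion_diff {L : List (Clause n k)} {σ : Assignment n}
    (hσ : Formula.SatBy (scan L) σ) {X : Finset (Assignment n)}
    (hX : ∀ τ ∈ X, Formula.SatBy (scan L) τ) {C : Clause n k} (hC : C ∈ L) :
    C ∉ falsifiedFamily k (flipOn σ (X.biUnion (diff σ)))
      (oneOf k (X.biUnion (diff σ)) (X.biUnion (diff σ))ᶜ) := by
  intro h
  obtain ⟨S, hS, hc, rfl⟩ := mem_falsifiedFamily.1 h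
  obtain ⟨i, hi, S', hS', -, rfl⟩ := mem_oneOf.1 hS
  obtain ⟨τ, hτ, hiτ⟩ := Finset.mem_biUnion.1 hi
  have h1 := satBy_of_satBy_scan hσ (hX τ hτ) hC
    (satBy_falsified.2 ⟨i, Finset.mem_insert_self _ _, by simp [flipOn, hi]⟩)
  obtain ⟨j, hj, hne⟩ := satBy_falsified.1 h1
  rcases Finset.mem_insert.1 hj with rfl | hj
  · rw [mem_diff] at hiτ
    simp only [flipOn, hi, if_true] at hne
    cases h1 : σ j <;> cases h2 : τ j <;> simp_all
  · have hjW := Finset.mem_compl.1 (hS' hj)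
    simp only [flipOn, hjW, if_false] at hne
    exact hjW (Finset.mem_biUnion.2 ⟨τ, hτ, mem_diff.2 hne.symm⟩)

/-- On later solutions the frozen literals stay false, so the truth of the clause is decided by the
value at `i`. Once scanned, the clause has the same truth value under all solutions, which would
freeze `i`. -/
theorem notMem_oneOf_frozen {L L' : List (Clause n k)} {ρ : Assignment n}
    (hρ : Formula.SatBy (scan L) ρ) {i : Fin n} (hi : i ∉ frozen (scan (L ++ L')))
    {C : Clause n k} (hC : C ∈ L ++ L') :
    C ∉ falsifiedFamily k ρ (oneOf k {i} (frozen (scan L))) := by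
  intro h
  obtain ⟨S, hS, hc, rfl⟩ := mem_falsifiedFamily.1 h
  obtain ⟨i', hi', S', hS', -, rfl⟩ := mem_oneOf.1 hS
  obtain rfl := Finset.mem_singleton.1 hi'
  refine hi (mem_frozen.2 fun σ τ hσ hτ => ?_)
  have key : ∀ σ : Assignment n, Formula.SatBy (scan (L ++ L')) σ →
      ((falsified ρ _ hc).SatBy σ ↔ σ i' ≠ ρ i') := by
    intro σ hσ
    rw [satBy_falsified]
    constructor
    · rintro ⟨j, hj, hne⟩
      rcases Finset.mem_insert.1 hj with rfl | hj
      · exact hne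
      · exact absurd (mem_frozen.1 (hS' hj) σ ρ hσ.of_append hρ) hne
    · exact fun h => ⟨i', Finset.mem_insert_self _ _, h⟩
  have h1 : σ i' ≠ ρ i' → τ i' ≠ ρ i' := fun h =>
    (key τ hτ).1 (satBy_of_satBy_scan hσ hτ hC ((key σ hσ).2 h))
  have h2 : τ i' ≠ ρ i' → σ i' ≠ ρ i' := fun h =>
    (key σ hσ).1 (satBy_of_satBy_scan hτ hσ hC ((key τ hτ).2 h))
  cases hs : σ i' <;> cases ht : τ i' <;> cases hr : ρ i' <;> simp_all

theorem existsUnique_of_frozen {L : List (Clause n k)} (h : ∀ i, i ∈ frozen (scan L)) :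
    ∃! σ : Assignment n, Formula.SatBy (scan L) σ := by
  obtain ⟨σ, hσ⟩ := satisfiable_scan L
  exact ⟨σ, hσ, fun τ hτ => funext fun i => mem_frozen.1 (h i) τ σ hτ hσ⟩

/-- If fewer than a quarter of the variables are frozen, then either two satisfying assignments
are far apart, or the sets on which satisfying assignments differ from a given one have a union
of intermediate size. -/
theorem exists_of_card_frozen_lt {F : Formula n k} (σ : Assignment n)
    (h : 4 * (frozen F).card < n) :
    (∃ τ, F.SatBy τ ∧ n ≤ 4 * (diff σ τ).card) ∨
      ∃ X : Finset (Assignment n), (∀ τ ∈ X, F.SatBy τ) ∧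
        n ≤ 4 * (X.biUnion (diff σ)).card ∧ n ≤ 4 * (X.biUnion (diff σ))ᶜ.card := by
  classical
  by_contra hcon
  push Not at hcon
  obtain ⟨h1, h2⟩ := hcon
  have hc : ∀ W : Finset (Fin n), Wᶜ.card = n - W.card ∧ W.card ≤ n := fun W => by
    refine ⟨by rw [Finset.card_compl, Fintype.card_fin], ?_⟩
    simpa using Finset.card_le_univ W
  have key : ∀ X : Finset (Assignment n), (∀ τ ∈ X, F.SatBy τ) →
      4 * (X.biUnion (diff σ)).card < n := by
    intro X
    induction X using Finset.induction_on with
    | empty => intro _; simp; omega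
    | insert τ X _ ih =>
      intro hX
      have h3 := ih fun τ' hτ' => hX τ' (Finset.mem_insert_of_mem hτ')
      have h4 := h1 τ (hX τ (Finset.mem_insert_self _ _))
      have h5 := h2 (insert τ X) hX
      rw [Finset.biUnion_insert] at h5 ⊢
      -- Two sets smaller than `n / 4` have a union smaller than `n / 2`, so its complement is
      -- large; as intermediate sizes are excluded, the union is again below `n / 4`.
      have h6 := Finset.card_union_le (diff σ τ) (X.biUnion (diff σ))
      have h7 := hc (diff σ τ ∪ X.biUnion (diff σ))
      by_contra hcon
      have := h5 (by omega)
      omega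
  have h3 := key (solutions F) fun τ hτ => mem_solutions.1 hτ
  -- Of two solutions that differ at `i`, one differs from `σ` there. Hence the union over all
  -- solutions exceeds `3n / 4`, against `h3`.
  have h4 : (frozen F)ᶜ ⊆ (solutions F).biUnion (diff σ) := by
    intro i hi
    rw [Finset.mem_compl, mem_frozen] at hi
    push Not at hi
    obtain ⟨τ, τ', hτ, hτ', hne⟩ := hi
    rw [Finset.mem_biUnion]
    by_cases hi : σ i = τ i
    · exact ⟨τ', mem_solutions.2 hτ', mem_diff.2 (hi ▸ hne)⟩
    · exact ⟨τ, mem_solutions.2 hτ, mem_diff.2 hi⟩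
  have h5 := Finset.card_le_card h4
  have h6 := hc (frozen F)
  omega

end Structure

/-! ### Densities of the avoided families and the union bound -/

section Counting

variable {n k : ℕ}

/-- Each factor of the falling factorial of `s` is at least `n / 4 - n / 8 = n / 8`. -/
theorem pow_le_mul_choose {n k r s : ℕ} (hn : 8 * k ≤ n) (hr : r ≤ k) (hs : n ≤ 4 * s) :
    (n : ℝ) ^ r ≤ 8 ^ k * k.factorial * s.choose r := by
  have h1 : ((s + 1 - r) ^ r : ℕ) ≤ r.factorial * s.choose r := by
    have := Nat.pow_sub_le_descFactorial s r
    rwa [Nat.descFactorial_eq_factorial_mul_choose] at this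
  have h2 : n ^ r ≤ 8 ^ k * k.factorial * s.choose r := by
    calc n ^ r ≤ (8 * (s + 1 - r)) ^ r := Nat.pow_le_pow_left (by omega) r
      _ = 8 ^ r * (s + 1 - r) ^ r := mul_pow _ _ _
      _ ≤ 8 ^ k * (k.factorial * s.choose r) := by
        refine Nat.mul_le_mul (Nat.pow_le_pow_right (by norm_num) hr) (h1.trans ?_)
        exact Nat.mul_le_mul_right _ (Nat.factorial_le hr)
      _ = _ := by ring
  exact_mod_cast h2

theorem card_clause_le (n k : ℕ) : (Fintype.card (Clause n k) : ℝ) ≤ 2 ^ k * (n : ℝ) ^ k := by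
  have h1 : Fintype.card (Clause n k) ≤
      ((Finset.univ : Finset (Literal n)).powersetCard k).card := by
    rw [← Finset.card_univ]
    refine Finset.card_le_card_of_injOn (fun C => C.1) ?_ ?_
    · intro C _
      exact Finset.mem_powersetCard.2 ⟨Finset.subset_univ _, C.2.1⟩
    · intro C _ C' _ h
      exact Subtype.ext h
  have h2 : ((Finset.univ : Finset (Literal n)).powersetCard k).card ≤ (n * 2) ^ k := by
    rw [Finset.card_powersetCard, Finset.card_univ]
    simpa using Nat.choose_le_pow (n * 2) k
  have h3 : Fintype.card (Clause n k) ≤ 2 ^ k * n ^ k := by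
    rw [← mul_pow, mul_comm 2 n]
    exact h1.trans h2
  exact_mod_cast h3

/-- A lower bound for the proportion of clauses in the families to be avoided. -/
noncomputable def rate (k : ℕ) : ℝ := (4 * (8 ^ k * k.factorial) * 2 ^ k)⁻¹

theorem rate_pos (k : ℕ) : 0 < rate k := by
  unfold rate
  positivity

theorem rate_le_one (k : ℕ) : rate k ≤ 1 := by
  unfold rate
  refine inv_le_one_of_one_le₀ ?_
  have h : 1 ≤ 4 * (8 ^ k * k.factorial) * 2 ^ k := Nat.one_le_iff_ne_zero.2 (by positivity)
  exact_mod_cast h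

theorem rate_mul_card_clause_le (n k : ℕ) :
    rate k * Fintype.card (Clause n k) * (4 * (8 ^ k * k.factorial)) ≤ (n : ℝ) ^ k := by
  calc rate k * Fintype.card (Clause n k) * (4 * (8 ^ k * k.factorial))
      ≤ rate k * (2 ^ k * (n : ℝ) ^ k) * (4 * (8 ^ k * k.factorial)) := by
        have := card_clause_le n k
        have := (rate_pos k).le
        gcongr
    _ = (n : ℝ) ^ k := by
        unfold rate
        field_simp

theorem rate_le_powersetCard (hn : 8 * k ≤ n) (ρ : Assignment n) {D : Finset (Fin n)}
    (hD : n ≤ 4 * D.card) :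
    rate k * Fintype.card (Clause n k) ≤ (falsifiedFamily k ρ (D.powersetCard k)).card := by
  have h1 := rate_mul_card_clause_le n k
  have h2 := pow_le_mul_choose hn le_rfl hD
  have h3 : (D.card.choose k : ℝ) ≤ (falsifiedFamily k ρ (D.powersetCard k)).card := by
    have := card_le_card_falsifiedFamily (k := k) (ρ := ρ) (𝒮 := D.powersetCard k)
      fun S hS => (Finset.mem_powersetCard.1 hS).2
    rw [Finset.card_powersetCard] at this
    exact_mod_cast this
  have hK : (0 : ℝ) < 8 ^ k * k.factorial := by positivity
  refine le_trans (le_of_mul_le_mul_right ?_ hK) h3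
  have h4 : 0 ≤ rate k * Fintype.card (Clause n k) * (8 ^ k * k.factorial) := by
    have := rate_pos k
    positivity
  linarith

/-- Keeping `V.card` explicit covers both uses: `V.card ≥ n / 4` gives density `rate k` (hence the 4
in `rate`), and a singleton gives density at least `rate k / n`. -/
theorem rate_le_oneOf (hk : 1 ≤ k) (hn : 8 * k ≤ n) (ρ : Assignment n)
    {V X : Finset (Fin n)} (hVX : Disjoint V X) (hX : n ≤ 4 * X.card) :
    rate k * Fintype.card (Clause n k) * (4 * V.card) ≤
      n * (falsifiedFamily k ρ (oneOf k V X)).card := by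
  obtain ⟨k, rfl⟩ : ∃ l, k = l + 1 := ⟨k - 1, by omega⟩
  have h1 := rate_mul_card_clause_le n (k + 1)
  have h2 := pow_le_mul_choose hn (Nat.le_succ k) hX
  have h3 : (V.card * X.card.choose k : ℝ) ≤
      (falsifiedFamily (k + 1) ρ (oneOf (k + 1) V X)).card := by
    have := card_le_card_falsifiedFamily (k := k + 1) (ρ := ρ) (𝒮 := oneOf (k + 1) V X)
      fun S hS => card_of_mem_oneOf hk hVX hS
    rw [card_oneOf hVX, Nat.add_sub_cancel] at this
    exact_mod_cast this
  have hK : (0 : ℝ) < 8 ^ (k + 1) * (k + 1).factorial := by positivity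
  refine le_trans (le_of_mul_le_mul_right ?_ hK)
    (mul_le_mul_of_nonneg_left h3 (Nat.cast_nonneg n))
  calc _ = rate (k + 1) * Fintype.card (Clause n (k + 1)) *
        (4 * (8 ^ (k + 1) * (k + 1).factorial)) * V.card := by ring
    _ ≤ (n : ℝ) ^ (k + 1) * V.card := by gcongr
    _ = n * V.card * (n : ℝ) ^ k := by ring
    _ ≤ n * V.card * (8 ^ (k + 1) * (k + 1).factorial * X.card.choose k) := by gcongr
    _ = _ := by ring

theorem nonempty_clause (h : k ≤ n) : Nonempty (Clause n k) := by
  obtain ⟨S, -, hS⟩ := Finset.exists_subset_card_eq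
    (show k ≤ (Finset.univ : Finset (Fin n)).card by simpa using h)
  exact ⟨falsified (fun _ => true) S hS⟩

/-- The orderings for which two satisfying assignments at distance at least `n / 4` exist after
`a` steps are among these. -/
noncomputable def farPair (k a : ℕ) (p : Assignment n × Finset (Fin n)) :
    Finset (Ordering n k) :=
  avoiding (fun _ => n ≤ 4 * p.2.card)
    (fun _ => falsifiedFamily k p.1 (p.2.powersetCard k)) 0 a

/-- The orderings for which the sets on which solutions after `a` steps differ have a union of
intermediate size are among these. -/
noncomputable def midUnion (k a : ℕ) (p : Assignment n × Finset (Fin n)) :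
    Finset (Ordering n k) :=
  avoiding (fun _ => n ≤ 4 * p.2.card ∧ n ≤ 4 * p.2ᶜ.card)
    (fun _ => falsifiedFamily k (flipOn p.1 p.2) (oneOf k p.2 p.2ᶜ)) 0 a

/-- The orderings for which a quarter of the variables are frozen after `a` steps but `i` is
unfrozen after `b` steps are among these. -/
noncomputable def unfrozenAt (k a b : ℕ) (i : Fin n) : Finset (Ordering n k) :=
  avoiding (fun L => i ∉ frozen (scan L) ∧ n ≤ 4 * (frozen (scan L)).card)
    (fun L => falsifiedFamily k (satisfiable_scan L).choose (oneOf k {i} (frozen (scan L)))) a b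

theorem card_farPair_le (hn : 8 * k ≤ n) (a : ℕ)
    (p : Assignment n × Finset (Fin n)) :
    ((farPair k a p).card : ℝ) ≤ Real.exp (-(rate k * a)) * Nat.card (Ordering n k) := by
  have := nonempty_clause (show k ≤ n by omega)
  have h := card_avoiding_le (fun _ => n ≤ 4 * p.2.card)
    (fun _ => falsifiedFamily k p.1 (p.2.powersetCard k)) (Nat.zero_le a) (rate k)
    fun L hL => rate_le_powersetCard hn p.1 hL
  simpa [farPair] using h

theorem card_midUnion_le (hk : 1 ≤ k) (hn : 8 * k ≤ n) (a : ℕ)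
    (p : Assignment n × Finset (Fin n)) :
    ((midUnion k a p).card : ℝ) ≤ Real.exp (-(rate k * a)) * Nat.card (Ordering n k) := by
  have := nonempty_clause (show k ≤ n by omega)
  have h := card_avoiding_le (fun _ => n ≤ 4 * p.2.card ∧ n ≤ 4 * p.2ᶜ.card)
    (fun _ => falsifiedFamily k (flipOn p.1 p.2) (oneOf k p.2 p.2ᶜ)) (Nat.zero_le a) (rate k)
    fun L hL => by
      have h1 := rate_le_oneOf hk hn (flipOn p.1 p.2) disjoint_compl_right hL.2
      have hn0 : (0 : ℝ) < n := by exact_mod_cast (show 0 < n by omega)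
      have h2 : (n : ℝ) ≤ 4 * p.2.card := by exact_mod_cast hL.1
      refine le_of_mul_le_mul_left (le_trans ?_ h1) hn0
      rw [mul_comm]
      have := rate_pos k
      gcongr
  simpa [midUnion] using h

theorem card_unfrozenAt_le (hk : 1 ≤ k) (hn : 8 * k ≤ n) {a b : ℕ} (hab : a ≤ b) (i : Fin n) :
    ((unfrozenAt k a b i).card : ℝ) ≤
      Real.exp (-(rate k / n * ((b : ℝ) - a))) * Nat.card (Ordering n k) := by
  have := nonempty_clause (show k ≤ n by omega)
  refine card_avoiding_le _ _ hab _ fun L hL => ?_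
  have h1 := rate_le_oneOf hk hn (satisfiable_scan L).choose
    (Finset.disjoint_singleton_left.2 hL.1) hL.2
  have hn0 : (0 : ℝ) < n := by exact_mod_cast (show 0 < n by omega)
  rw [div_mul_eq_mul_div, div_le_iff₀' hn0]
  refine le_trans ?_ h1
  have h2 : 0 ≤ rate k * Fintype.card (Clause n k) := by
    have := rate_pos k
    positivity
  simp only [Finset.card_singleton, Nat.cast_one]
  linarith

/-- The orderings that may lead to several satisfying assignments. -/
noncomputable def badOrderings (n k a b : ℕ) : Finset (Ordering n k) := by
  classical
  exact (Finset.univ.biUnion (farPair k a) ∪ Finset.univ.biUnion (midUnion k a)) ∪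
    Finset.univ.biUnion (unfrozenAt k a b)

theorem mem_badOrderings (hk : 1 ≤ k) {a b : ℕ} (hab : a ≤ b) {e : Ordering n k}
    (he : ¬ ∃! σ : Assignment n, Formula.SatBy (processFormula b e) σ) :
    e ∈ badOrderings n k a b := by
  classical
  simp only [badOrderings, Finset.mem_union, Finset.mem_biUnion, Finset.mem_univ, true_and]
  have hmem : ∀ j : Fin (Fintype.card (Clause n k)), ∀ c, j.1 < c →
      e j ∈ (List.ofFn e).take c := fun j c hj => (mem_take_ofFn _ _ _).2 ⟨j, hj, rfl⟩
  by_cases hF : n ≤ 4 * (frozen (processFormula a e)).card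
  · right
    obtain ⟨i, hi⟩ : ∃ i, i ∉ frozen (processFormula b e) := by
      by_contra hcon
      push Not at hcon
      exact he (existsUnique_of_frozen hcon)
    refine ⟨i, mem_avoiding.2 ?_⟩
    obtain ⟨L', hL'⟩ := List.take_prefix_take_left (l := List.ofFn e) hab
    replace hL' := hL'.symm
    rw [processFormula, hL'] at hi
    -- Frozen variables stay frozen, so `i` is already unfrozen after `a` steps.
    refine ⟨⟨fun h => hi ?_, hF⟩, fun j hj => ?_⟩
    · exact mem_frozen.2 fun σ τ hσ hτ => mem_frozen.1 h σ τ hσ.of_append hτ.of_append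
    · have hC := hmem j b hj
      rw [hL'] at hC
      exact notMem_oneOf_frozen (satisfiable_scan _).choose_spec hi hC
  · left
    obtain ⟨σ, hσ⟩ := satisfiable_scan ((List.ofFn e).take a)
    rcases exists_of_card_frozen_lt σ (not_le.1 hF) with ⟨τ, hτ, hd⟩ | ⟨X, hX, h1, h2⟩
    · exact Or.inl ⟨(τ, diff σ τ), mem_avoiding.2
        ⟨hd, fun j hj => notMem_powersetCard_diff hk hσ hτ (hmem j a hj)⟩⟩
    · exact Or.inr ⟨(σ, X.biUnion (diff σ)), mem_avoiding.2
        ⟨⟨h1, h2⟩, fun j hj => notMem_oneOf_biUnion_diff hσ hX (hmem j a hj)⟩⟩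

theorem card_biUnion_univ_le {ι β : Type*} [Fintype ι] [DecidableEq β] (f : ι → Finset β)
    (x : ℝ) (h : ∀ i, ((f i).card : ℝ) ≤ x) :
    ((Finset.univ.biUnion f).card : ℝ) ≤ Fintype.card ι * x := by
  calc ((Finset.univ.biUnion f).card : ℝ) ≤ ∑ i, ((f i).card : ℝ) := by
        exact_mod_cast Finset.card_biUnion_le
    _ ≤ ∑ _i : ι, x := Finset.sum_le_sum fun i _ => h i
    _ = _ := by simp

theorem card_badOrderings_le (hk : 1 ≤ k) (hn : 8 * k ≤ n) {a b : ℕ} (hab : a ≤ b) :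
    ((badOrderings n k a b).card : ℝ) ≤
      (2 * (4 ^ n * Real.exp (-(rate k * a))) + n * Real.exp (-(rate k / n * ((b : ℝ) - a)))) *
        Nat.card (Ordering n k) := by
  classical
  have h1 := card_biUnion_univ_le (farPair (n := n) k a) _ (card_farPair_le hn a)
  have h2 := card_biUnion_univ_le (midUnion (n := n) k a) _ (card_midUnion_le hk hn a)
  have h3 := card_biUnion_univ_le (unfrozenAt (n := n) k a b) _ (card_unfrozenAt_le hk hn hab)
  have hc : (Fintype.card (Assignment n × Finset (Fin n)) : ℝ) = 4 ^ n := by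
    simp only [Fintype.card_prod, Fintype.card_fun, Fintype.card_bool, Fintype.card_fin,
      Fintype.card_finset]
    push_cast
    rw [← mul_pow]
    norm_num
  rw [hc] at h1 h2
  rw [Fintype.card_fin] at h3
  have h4 : ((badOrderings n k a b).card : ℝ) ≤
      ((Finset.univ.biUnion (farPair (n := n) k a)).card +
        (Finset.univ.biUnion (midUnion (n := n) k a)).card) +
        (Finset.univ.biUnion (unfrozenAt (n := n) k a b)).card := by
    have h5 := Finset.card_union_le
      (Finset.univ.biUnion (farPair (n := n) k a) ∪ Finset.univ.biUnion (midUnion (n := n) k a))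
      (Finset.univ.biUnion (unfrozenAt (n := n) k a b))
    have h6 := Finset.card_union_le
      (Finset.univ.biUnion (farPair (n := n) k a)) (Finset.univ.biUnion (midUnion (n := n) k a))
    have h7 := h5.trans (Nat.add_le_add_right h6 _)
    unfold badOrderings
    exact_mod_cast h7
  linarith

end Counting

/-! ### Passage to probabilities and the limit -/

section Limit

theorem one_sub_le_uniformOfFintype {Ω : Type*} [Fintype Ω] [Nonempty Ω] (S : Set Ω)
    (B : Finset Ω) (hB : ∀ x, x ∉ S → x ∈ B) (η : ℝ) (h : (B.card : ℝ) ≤ η * Nat.card Ω) :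
    1 - ENNReal.ofReal η ≤ (PMF.uniformOfFintype Ω).toOuterMeasure S := by
  classical
  set p := PMF.uniformOfFintype Ω
  have hη : p.toOuterMeasure (B : Set Ω) ≤ ENNReal.ofReal η := by
    rw [PMF.toOuterMeasure_uniformOfFintype_apply]
    have hpos : (0 : ℝ) < Fintype.card Ω := by exact_mod_cast Fintype.card_pos
    rw [Nat.card_eq_fintype_card] at h
    have h1 : (B.card : ℝ) / Fintype.card Ω ≤ η := by rwa [div_le_iff₀ hpos]
    refine le_trans (le_of_eq ?_) (ENNReal.ofReal_le_ofReal h1)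
    rw [ENNReal.ofReal_div_of_pos hpos, ENNReal.ofReal_natCast, ENNReal.ofReal_natCast]
    simp
  have h1 : (1 : ENNReal) ≤ p.toOuterMeasure (S ∪ B) := by
    refine ((PMF.toOuterMeasure_apply_eq_one_iff p _).2 fun x _ => ?_).ge
    by_cases hx : x ∈ S
    · exact Or.inl hx
    · exact Or.inr (hB x hx)
  rw [tsub_le_iff_right]
  exact h1.trans ((MeasureTheory.measure_union_le _ _).trans (by gcongr))

/-- Here `δ * m ≥ 6 n log n`, so each half of the scan contributes about `3 n log n`. With `4 ^ n ≤
exp (2 n)` and `log n ≥ 1` this leaves `exp (1 - n)`, the 1 absorbing the rounding in `m / 2`; in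
the second term `exp (-2 log n)` already suffices. -/
theorem error_le {δ : ℝ} (hδ : 0 < δ) (hδ1 : δ ≤ 1) {n m : ℕ} (hn : 3 ≤ n)
    (hm : 6 / δ * Real.log n ≤ (m : ℝ) / n) :
    2 * (4 ^ n * Real.exp (-(δ * (m / 2 : ℕ)))) +
        n * Real.exp (-(δ / n * ((m : ℝ) - (m / 2 : ℕ)))) ≤
      2 * Real.exp (1 - n) + (n : ℝ)⁻¹ := by
  have hn0 : (0 : ℝ) < n := by exact_mod_cast (show 0 < n by omega)
  have hlog : 1 ≤ Real.log n := by
    rw [Real.le_log_iff_exp_le hn0]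
    have : (3 : ℝ) ≤ n := by exact_mod_cast hn
    linarith [Real.exp_one_lt_d9]
  have h1 : 6 * Real.log n * n ≤ δ * m := by
    rw [le_div_iff₀ hn0, div_mul_eq_mul_div, div_mul_eq_mul_div, div_le_iff₀ hδ] at hm
    linarith
  have hlow : (m : ℝ) ≤ 2 * (m / 2 : ℕ) + 1 := by
    exact_mod_cast (show m ≤ 2 * (m / 2) + 1 by omega)
  have hup : 2 * ((m / 2 : ℕ) : ℝ) ≤ m := by
    exact_mod_cast (show 2 * (m / 2) ≤ m by omega)
  have h4 : (4 : ℝ) ^ n ≤ Real.exp (2 * n) := by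
    have : (4 : ℝ) ≤ Real.exp 2 := by
      have h := Real.exp_one_gt_d9
      rw [show (2 : ℝ) = 1 + 1 by norm_num, Real.exp_add]
      nlinarith
    calc (4 : ℝ) ^ n ≤ Real.exp 2 ^ n := by gcongr
      _ = Real.exp (2 * n) := by rw [← Real.exp_nat_mul, mul_comm]
  refine add_le_add ?_ ?_
  · have h5 : δ * m ≤ 2 * (δ * (m / 2 : ℕ)) + 1 := by nlinarith
    have h6 : (n : ℝ) ≤ Real.log n * n := by nlinarith
    calc _ ≤ 2 * (Real.exp (2 * n) * Real.exp (-(δ * (m / 2 : ℕ)))) := by gcongr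
      _ = 2 * Real.exp (2 * n + -(δ * (m / 2 : ℕ))) := by rw [Real.exp_add]
      _ ≤ _ := by
        gcongr
        linarith
  · have h5 : 2 * Real.log n ≤ δ / n * ((m : ℝ) - (m / 2 : ℕ)) := by
      rw [div_mul_eq_mul_div, le_div_iff₀ hn0]
      nlinarith
    calc (n : ℝ) * Real.exp (-(δ / n * ((m : ℝ) - (m / 2 : ℕ))))
        ≤ n * Real.exp (-(2 * Real.log n)) := by gcongr
      _ = (n : ℝ)⁻¹ := by
        rw [two_mul, neg_add, Real.exp_add, Real.exp_neg, Real.exp_log hn0]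
        field_simp

theorem tendsto_error :
    Filter.Tendsto (fun n : ℕ => 2 * Real.exp (1 - n) + (n : ℝ)⁻¹) Filter.atTop (nhds 0) := by
  have h1 : Filter.Tendsto (fun n : ℕ => Real.exp (1 - n)) Filter.atTop (nhds 0) := by
    refine Real.tendsto_exp_atBot.comp ?_
    simp only [sub_eq_add_neg]
    exact Filter.tendsto_atBot_add_const_left _ _
      (Filter.tendsto_neg_atTop_atBot.comp tendsto_natCast_atTop_atTop)
  simpa using (h1.const_mul 2).add tendsto_inv_atTop_nhds_zero_nat

end Limit

end RandomSat

/-! ### The main theorem -/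

theorem mainTheorem3 (k : ℕ) (hk : 1 ≤ k) :
    ∃ c : ℝ, 0 < c ∧
      ∀ m : ℕ → ℕ,
        (∀ᶠ n : ℕ in Filter.atTop, m n ≤ 2 ^ k * n.choose k) →
        (∀ᶠ n : ℕ in Filter.atTop, c * Real.log (n : ℝ) ≤ (m n : ℝ) / (n : ℝ)) →
        Filter.Tendsto
          (fun n : ℕ => (RandomSat.Psat k n (m n)).toOuterMeasure
            {F | ∃! σ : RandomSat.Assignment n, RandomSat.Formula.SatBy F σ})
          Filter.atTop (nhds 1) := by
  open RandomSat in
  refine ⟨6 / rate k, div_pos (by norm_num) (rate_pos k), fun m _ hm => ?_⟩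
  have hlim : Filter.Tendsto
      (fun n : ℕ => 1 - ENNReal.ofReal (2 * Real.exp (1 - n) + (n : ℝ)⁻¹))
      Filter.atTop (nhds 1) := by
    have h := ENNReal.Tendsto.sub (tendsto_const_nhds (x := (1 : ENNReal)))
      (ENNReal.tendsto_ofReal tendsto_error) (Or.inl ENNReal.one_ne_top)
    simpa using h
  refine tendsto_of_tendsto_of_tendsto_of_le_of_le' hlim tendsto_const_nhds ?_ ?_
  · filter_upwards [hm, Filter.eventually_ge_atTop (8 * k), Filter.eventually_ge_atTop 3]
      with n hmn hn h3
    have hab : m n / 2 ≤ m n := Nat.div_le_self _ _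
    rw [Psat, PMF.toOuterMeasure_map_apply]
    refine one_sub_le_uniformOfFintype _ (badOrderings n k (m n / 2) (m n))
      (fun e he => mem_badOrderings hk hab he) _ ((card_badOrderings_le hk hn hab).trans ?_)
    exact mul_le_mul_of_nonneg_right (error_le (rate_pos k) (rate_le_one k) h3 hmn)
      (Nat.cast_nonneg _)
  · refine Filter.Eventually.of_forall fun n => ?_
    rw [← (PMF.toOuterMeasure_apply_eq_one_iff (Psat k n (m n)) Set.univ).2 (Set.subset_univ _)]
    exact MeasureTheory.measure_mono (Set.subset_univ _)
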